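/- Let $A$ be a finite set and $d\ge 1$. Equip $A^{\mathbb{Z}^d}$ with the metric $d_C(x,y)=2^{-\min\{\|i\|_\infty\,:\,x_i\neq y_i\}}$ (and $d_C(x,x)=0$). A cellular automaton (CA) of dimension $d$ over $A$ is given by a finite neighbourhood $U\subset\mathbb{Z}^d$ and a local rule $f:A^U\to A$; it acts on $A^{\mathbb{Z}^d}$ by $F(x)(m)=f\big((x(m+u))_{u\in U}\big)$. A configuration $x$ is an equicontinuous point of $F$ if for every $\varepsilon>0$ there is $\delta>0$ such that for all $y$ with $d_C(x,y)<\delta$ one has $d_C(F^n(x),F^n(y))<\varepsilon$ for all $n\in\mathbb{N}$. (1) For every dimension $d\ge 2$ there exist a finite alphabet $A$ and a CA of dimension $d$ over $A$ whose set of equicontinuous points is countably infinite. (2) By contrast, every CA of dimension $1$ over a finite alphabet with at least two elements that has an equicontinuous point has uncountably many equicontinuous points. -/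

import Mathlib

/-- Configurations over the alphabet `A` on the lattice `ℤ^d`. -/
abbrev Config (A : Type*) (d : ℕ) : Type _ := (Fin d → ℤ) → A

/-- The sup norm of a lattice point, as a natural number. -/
def supNorm {d : ℕ} (i : Fin d → ℤ) : ℕ := Finset.univ.sup fun k => (i k).natAbs

open Classical in
/-- The Cantor metric `d_C(x, y) = 2 ^ (-min {‖i‖_∞ : x i ≠ y i})`, with value `0` if `x = y`. -/
noncomputable def cantorDist {A : Type*} {d : ℕ} (x y : Config A d) : ℝ :=
  if x = y then 0 else (2 : ℝ)⁻¹ ^ sInf {n : ℕ | ∃ i, supNorm i = n ∧ x i ≠ y i}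

/-- A cellular automaton of dimension `d` over the alphabet `A` (taken finite in the statements):
a finite neighbourhood in `ℤ^d` and a local rule. -/
structure CellularAutomaton (A : Type*) (d : ℕ) where
  /-- the neighbourhood -/
  nbhd : Finset (Fin d → ℤ)
  /-- the local rule -/
  rule : (nbhd → A) → A

/-- The global map `F(x)(m) = f((x(m + u))_{u ∈ U})`. -/
def CellularAutomaton.globalMap {A : Type*} {d : ℕ} (F : CellularAutomaton A d) :
    Config A d → Config A d :=
  fun x m => F.rule fun u => x (m + u.1)

/-- `x` is an equicontinuous point of `F`: for all `ε > 0` there is `δ > 0` such that every `y`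
at distance less than `δ` from `x` satisfies `d(F^n x, F^n y) < ε` for all `n`. -/
def CellularAutomaton.IsEquicontinuousPoint {A : Type*} {d : ℕ} (F : CellularAutomaton A d)
    (x : Config A d) : Prop :=
  ∀ ε : ℝ, 0 < ε → ∃ δ : ℝ, 0 < δ ∧ ∀ y : Config A d, cantorDist x y < δ →
    ∀ n : ℕ, cantorDist (F.globalMap^[n] x) (F.globalMap^[n] y) < ε

/-- The set of equicontinuous points of `F`. -/
def CellularAutomaton.equicontinuousPoints {A : Type*} {d : ℕ} (F : CellularAutomaton A d) :
    Set (Config A d) :=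
  {x | F.IsEquicontinuousPoint x}

/-! ### The sup norm and the Cantor metric -/

/-! Dimension one: an equicontinuous point supplies a central word that determines the orbit on
`[-r, r]` at all times, where `r` bounds the neighbourhood. No information crosses such a word
(`IsBlocking.eq_between`). Repeating it with one free letter between consecutive copies gives an
equicontinuous point for each element of `ℤ → A`.

Dimension at least two: a solid cell records on which faces of a cube around a centre it lies. A
solid cell whose neighbourhood does not fit such a pattern melts, and fluid never solidifies.
Missing outward neighbours are tolerated, so damage outside a ball cannot eat into it, and every
`perfect c` is equicontinuous (`iterate_eq_perfect`).

Conversely, replace an equicontinuous point outside a large ball by fluid with bit `b`. The finitely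
many solid cells settle into stable clusters, which never block both flow directions
(`not_isSolid_or`), so every cell that melts eventually carries `b` (`eventually_eq_inr`). Comparing
the two bits shows that no cell near the origin ever melts. Hence all local patterns are intact, and
the surviving finite cluster contains a centre (`exists_centre`), which forces the point to be some
`perfect c` (`eq_perfect`). The equicontinuous points thus correspond to the centres in `ℤ^d`. -/

theorem supNorm_le_iff {d : ℕ} {i : Fin d → ℤ} {k : ℕ} :
    supNorm i ≤ k ↔ ∀ j, (i j).natAbs ≤ k := by
  simp [supNorm]

theorem natAbs_le_supNorm {d : ℕ} (i : Fin d → ℤ) (j : Fin d) : (i j).natAbs ≤ supNorm i :=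
  supNorm_le_iff.1 le_rfl j

theorem supNorm_add_le {d : ℕ} (i j : Fin d → ℤ) : supNorm (i + j) ≤ supNorm i + supNorm j := by
  rw [supNorm_le_iff]
  intro l
  have h1 := natAbs_le_supNorm i l
  have h2 := natAbs_le_supNorm j l
  simp only [Pi.add_apply]
  omega

theorem supNorm_neg {d : ℕ} (i : Fin d → ℤ) : supNorm (-i) = supNorm i := by
  simp [supNorm]

theorem supNorm_eq_zero {d : ℕ} {i : Fin d → ℤ} : supNorm i = 0 ↔ i = 0 := by
  rw [← Nat.le_zero, supNorm_le_iff, funext_iff]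
  simp

theorem finite_setOf_supNorm_le (d k : ℕ) : {i : Fin d → ℤ | supNorm i ≤ k}.Finite := by
  refine (Set.finite_Icc (fun _ : Fin d => -(k : ℤ)) (fun _ => (k : ℤ))).subset fun i hi => ?_
  have h := supNorm_le_iff.1 hi
  exact ⟨fun j => by have := h j; dsimp only; omega, fun j => by have := h j; dsimp only; omega⟩

/-- The configurations `x` and `y` coincide on the ball of radius `k` around the origin. -/
def AgreeOn {A : Type*} {d : ℕ} (k : ℕ) (x y : Config A d) : Prop :=
  ∀ i, supNorm i ≤ k → x i = y i

theorem cantorDist_lt_iff {A : Type*} {d : ℕ} {x y : Config A d} {k : ℕ} :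
    cantorDist x y < (2 : ℝ)⁻¹ ^ k ↔ AgreeOn k x y := by
  unfold cantorDist
  split_ifs with h
  · exact iff_of_true (by positivity) fun i _ => by rw [h]
  · have hne : {n : ℕ | ∃ i, supNorm i = n ∧ x i ≠ y i}.Nonempty := by
      obtain ⟨i, hi⟩ := Function.ne_iff.1 h
      exact ⟨_, i, rfl, hi⟩
    rw [pow_lt_pow_iff_right_of_lt_one₀ (by norm_num) (by norm_num)]
    constructor
    · intro hk i hi
      by_contra hne'
      exact absurd (Nat.sInf_le (show supNorm i ∈ {n | ∃ i, supNorm i = n ∧ x i ≠ y i} from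
        ⟨i, rfl, hne'⟩)) (by omega)
    · intro hag
      obtain ⟨i, hi, hxy⟩ := Nat.sInf_mem hne
      by_contra hk
      exact hxy (hag i (by omega))

theorem CellularAutomaton.isEquicontinuousPoint_iff {A : Type*} {d : ℕ}
    {F : CellularAutomaton A d} {x : Config A d} :
    F.IsEquicontinuousPoint x ↔ ∀ k : ℕ, ∃ R : ℕ, ∀ y, AgreeOn R x y →
      ∀ n, AgreeOn k (F.globalMap^[n] x) (F.globalMap^[n] y) := by
  constructor
  · intro h k
    obtain ⟨δ, hδ, H⟩ := h ((2 : ℝ)⁻¹ ^ k) (by positivity)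
    obtain ⟨R, hR⟩ := exists_pow_lt_of_lt_one hδ (by norm_num : (2 : ℝ)⁻¹ < 1)
    exact ⟨R, fun y hy n => cantorDist_lt_iff.1 (H y ((cantorDist_lt_iff.2 hy).trans hR) n)⟩
  · intro h ε hε
    obtain ⟨k, hk⟩ := exists_pow_lt_of_lt_one hε (by norm_num : (2 : ℝ)⁻¹ < 1)
    obtain ⟨R, H⟩ := h k
    exact ⟨(2 : ℝ)⁻¹ ^ R, by positivity, fun y hy n =>
      (cantorDist_lt_iff.2 (H y (cantorDist_lt_iff.1 hy) n)).trans hk⟩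

/-! ### Dimension one: blocking words -/

namespace CellularAutomaton

theorem globalMap_translate {A : Type*} {d : ℕ} (F : CellularAutomaton A d) (x : Config A d)
    (p : Fin d → ℤ) (n : ℕ) :
    F.globalMap^[n] (fun m => x (p + m)) = fun m => F.globalMap^[n] x (p + m) := by
  induction n with
  | zero => rfl
  | succ n ih =>
    rw [Function.iterate_succ_apply', Function.iterate_succ_apply', ih]
    funext m
    simp only [globalMap, add_assoc]

theorem exists_nbhd_radius {A : Type*} {d : ℕ} (F : CellularAutomaton A d) :
    ∃ r : ℕ, ∀ u ∈ F.nbhd, supNorm u ≤ r :=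
  ⟨F.nbhd.sup supNorm, fun _ hu => Finset.le_sup (f := supNorm) hu⟩

/-- Every configuration of dimension one that agrees with `x` on `[-N, N]` has the same orbit
as `x` on `[-r, r]`. -/
def IsBlocking {A : Type*} (F : CellularAutomaton A 1) (x : Config A 1) (N r : ℕ) : Prop :=
  ∀ y, AgreeOn N x y → ∀ n, AgreeOn r (F.globalMap^[n] x) (F.globalMap^[n] y)

/-- Near `p` both orbits are translates of the orbit of `x`. -/
theorem IsBlocking.eq_of_translate {A : Type*} {F : CellularAutomaton A 1} {x : Config A 1}
    {N r : ℕ} (hb : F.IsBlocking x N r) {y z : Config A 1} {p : Fin 1 → ℤ}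
    (hy : AgreeOn N x fun m => y (p + m)) (hz : AgreeOn N x fun m => z (p + m)) (n : ℕ)
    {m : Fin 1 → ℤ} (hm : (m 0 - p 0).natAbs ≤ r) :
    F.globalMap^[n] y m = F.globalMap^[n] z m := by
  have h1 := hb _ hy n (m - p) (supNorm_le_iff.2 fun j => by
    rw [Subsingleton.elim j 0]; exact hm)
  have h2 := hb _ hz n (m - p) (supNorm_le_iff.2 fun j => by
    rw [Subsingleton.elim j 0]; exact hm)
  rw [globalMap_translate] at h1 h2
  simpa using h1.symm.trans h2

/-- Two configurations with the blocking word centred at `p` and at `q` that coincide between the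
two occurrences have the same orbit there. -/
theorem IsBlocking.eq_between {A : Type*} {F : CellularAutomaton A 1} {x : Config A 1}
    {N r : ℕ} (hb : F.IsBlocking x N r) (hr : ∀ u ∈ F.nbhd, supNorm u ≤ r)
    {y z : Config A 1} {p q : Fin 1 → ℤ}
    (hyp : AgreeOn N x fun m => y (p + m)) (hzp : AgreeOn N x fun m => z (p + m))
    (hyq : AgreeOn N x fun m => y (q + m)) (hzq : AgreeOn N x fun m => z (q + m))
    (hyz : ∀ m : Fin 1 → ℤ, p 0 ≤ m 0 → m 0 ≤ q 0 → y m = z m) (n : ℕ) :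
    ∀ m : Fin 1 → ℤ, p 0 ≤ m 0 → m 0 ≤ q 0 →
      F.globalMap^[n] y m = F.globalMap^[n] z m := by
  induction n with
  | zero => exact hyz
  | succ n ih =>
    intro m hpm hmq
    rw [Function.iterate_succ_apply', Function.iterate_succ_apply']
    unfold globalMap
    congr 1
    funext u
    have hu := (natAbs_le_supNorm u.1 0).trans (hr u.1 u.2)
    -- A neighbour is at most `r` away from `m`, so it can leave the interval only through the zones
    -- of radius `r` around `p` and `q`, which the blocking words control.
    by_cases h1 : ((m + u.1) 0 - p 0).natAbs ≤ r
    · exact hb.eq_of_translate hyp hzp n h1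
    by_cases h2 : ((m + u.1) 0 - q 0).natAbs ≤ r
    · exact hb.eq_of_translate hyq hzq n h2
    simp only [Pi.add_apply] at h1 h2
    apply ih <;> simp only [Pi.add_apply] <;> omega

/-- The configuration that repeats the word `x [-N, N]`, with the letters `s k` in between. -/
def interleave {A : Type*} (x : Config A 1) (N : ℕ) (s : ℤ → A) : Config A 1 := fun m =>
  if (m 0) % (2 * N + 2) = 2 * N + 1 then s (m 0 / (2 * N + 2))
  else x fun _ => (m 0) % (2 * N + 2) - N

theorem interleave_injective {A : Type*} (x : Config A 1) (N : ℕ) :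
    Function.Injective (interleave x N) := by
  intro s s' h
  funext k
  have h1 := congrFun h fun _ => (2 * N + 1) + (2 * N + 2) * k
  have h2 : ((2 * N + 1 : ℤ) + (2 * N + 2) * k) % (2 * N + 2) = 2 * N + 1 := by
    rw [Int.add_mul_emod_self_left]; exact Int.emod_eq_of_lt (by omega) (by omega)
  have h3 : ((2 * N + 1 : ℤ) + (2 * N + 2) * k) / (2 * N + 2) = k := by
    rw [Int.add_mul_ediv_left _ _ (by omega), Int.ediv_eq_zero_of_lt (by omega) (by omega),
      zero_add]
  simpa [interleave, h2, h3] using h1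

theorem agreeOn_interleave {A : Type*} (x : Config A 1) (N : ℕ) (s : ℤ → A) (k : ℤ) :
    AgreeOn N x fun m => interleave x N s ((fun _ => N + (2 * N + 2) * k) + m) := by
  intro i hi
  have h0 := supNorm_le_iff.1 hi 0
  have h2 : (N + (2 * N + 2) * k + i 0) % (2 * N + 2) = N + i 0 := by
    rw [show N + (2 * N + 2) * k + i 0 = N + i 0 + (2 * N + 2) * k by ring,
      Int.add_mul_emod_self_left]
    exact Int.emod_eq_of_lt (by omega) (by omega)
  simp only [interleave, Pi.add_apply, h2]
  rw [if_neg (by omega)]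
  congr 1
  funext j
  rw [Subsingleton.elim j 0]
  omega

theorem IsBlocking.isEquicontinuousPoint_interleave {A : Type*} {F : CellularAutomaton A 1}
    {x : Config A 1} {N r : ℕ} (hb : F.IsBlocking x N r) (hr : ∀ u ∈ F.nbhd, supNorm u ≤ r)
    (s : ℤ → A) : F.IsEquicontinuousPoint (interleave x N s) := by
  rw [isEquicontinuousPoint_iff]
  intro k
  set L : ℤ := 2 * N + 2 with hL
  have hLk : (k : ℤ) ≤ L * k := le_mul_of_one_le_left (by omega) (by omega)
  have hLk' : L * (-(k : ℤ) - 1) = -(L * k) - L := by ring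
  -- The ball of radius `k` lies between the copies numbered `-k - 1` and `k`; this radius covers
  -- both copies entirely.
  refine ⟨(L * k + 2 * L).toNat, fun y hy n i hi => ?_⟩
  have key : ∀ k' : ℤ, -(L * k) - L ≤ L * k' → L * k' ≤ L * k →
      AgreeOn N x fun m => y ((fun _ => N + L * k') + m) := by
    intro k' h1 h2 i hi
    rw [agreeOn_interleave x N s k' i hi]
    refine hy _ (supNorm_le_iff.2 fun j => ?_)
    have := supNorm_le_iff.1 hi j
    simp only [Pi.add_apply, ← hL]
    omega
  have hi0 := supNorm_le_iff.1 hi 0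
  refine hb.eq_between hr (p := fun _ => N + L * (-(k : ℤ) - 1)) (q := fun _ => N + L * k)
    (agreeOn_interleave x N s _) (key _ (by omega) (by omega))
    (agreeOn_interleave x N s _) (key _ (by omega) (by omega))
    (fun m h1 h2 => hy m (supNorm_le_iff.2 fun j => ?_)) n i ?_ ?_
  · rw [Subsingleton.elim j 0]
    omega
  · omega
  · omega

theorem not_countable_equicontinuousPoints {A : Type*} [Nontrivial A]
    (F : CellularAutomaton A 1) (h : F.equicontinuousPoints.Nonempty) :
    ¬ F.equicontinuousPoints.Countable := by
  obtain ⟨x, hx⟩ := h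
  obtain ⟨r, hr⟩ := F.exists_nbhd_radius
  obtain ⟨N, hb⟩ := isEquicontinuousPoint_iff.1 hx r
  have hb : F.IsBlocking x N r := hb
  intro hc
  have hc' : (Set.range (interleave x N)).Countable :=
    hc.mono (Set.range_subset_iff.2 fun s => hb.isEquicontinuousPoint_interleave hr s)
  have : Countable (ℤ → A) :=
    Set.countable_univ_iff.1 (Set.countable_of_injective_of_countable_image
      (interleave_injective x N).injOn (by rwa [Set.image_univ]))
  obtain ⟨f, hf⟩ := exists_surjective_nat (ℤ → A)
  -- Cantor's diagonal argument, on the nonnegative integers.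
  choose g hg using fun k : ℤ => exists_ne (f k.toNat k)
  obtain ⟨n, hn⟩ := hf g
  exact hg n (by rw [← hn, Int.toNat_natCast])

end CellularAutomaton

/-! ### Dimension at least two: solid cells around a centre, and a fluid around them -/

namespace SolidFluid

/-- The sign vector of `a`, restricted to the coordinates at which `a` attains its sup norm. -/
noncomputable def shellType {d : ℕ} (a : Fin d → ℤ) : Fin d → SignType := fun i =>
  if (a i).natAbs = supNorm a then SignType.sign (a i) else 0

/-- The vector of a sign vector. -/
def vec {d : ℕ} (τ : Fin d → SignType) : Fin d → ℤ := fun i => (τ i : ℤ)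

/-- The states: solid cells carry a shell type, fluid cells a bit. -/
abbrev State (d : ℕ) : Type := (Fin d → SignType) ⊕ Bool

theorem shellType_eq_one_iff {d : ℕ} {a : Fin d → ℤ} {i : Fin d} :
    shellType a i = 1 ↔ a i = supNorm a ∧ 0 < a i := by
  unfold shellType
  split_ifs with h
  · rw [sign_eq_one_iff]; omega
  · simp only [false_iff]; omega

theorem shellType_eq_neg_one_iff {d : ℕ} {a : Fin d → ℤ} {i : Fin d} :
    shellType a i = -1 ↔ a i = -supNorm a ∧ a i < 0 := by
  unfold shellType
  split_ifs with h
  · rw [sign_eq_neg_one_iff]; omega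
  · simp only [false_iff]; omega

theorem exists_natAbs_eq_supNorm {d : ℕ} {a : Fin d → ℤ} (ha : a ≠ 0) :
    ∃ i, (a i).natAbs = supNorm a := by
  obtain ⟨j, hj⟩ := Function.ne_iff.1 ha
  obtain ⟨i, -, hi⟩ := Finset.exists_mem_eq_sup Finset.univ ⟨j, Finset.mem_univ j⟩
    fun k => (a k).natAbs
  exact ⟨i, hi.symm⟩

theorem shellType_eq_zero {d : ℕ} {a : Fin d → ℤ} : shellType a = 0 ↔ a = 0 := by
  refine ⟨fun h => by_contra fun ha => ?_, ?_⟩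
  · obtain ⟨i, hi⟩ := exists_natAbs_eq_supNorm ha
    have h0 := congrFun h i
    rw [shellType, if_pos hi, Pi.zero_apply, sign_eq_zero_iff] at h0
    rw [h0] at hi
    exact ha (supNorm_eq_zero.1 hi.symm)
  · rintro rfl
    funext i
    simp [shellType]

theorem vec_eq_one_iff {d : ℕ} {τ : Fin d → SignType} {i : Fin d} : vec τ i = 1 ↔ τ i = 1 := by
  unfold vec; generalize τ i = s; revert s; decide

theorem vec_eq_neg_one_iff {d : ℕ} {τ : Fin d → SignType} {i : Fin d} :
    vec τ i = -1 ↔ τ i = -1 := by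
  unfold vec; generalize τ i = s; revert s; decide

theorem vec_eq_zero_iff {d : ℕ} {τ : Fin d → SignType} {i : Fin d} :
    vec τ i = 0 ↔ τ i = 0 := by
  unfold vec; generalize τ i = s; revert s; decide

theorem vec_cases {d : ℕ} (τ : Fin d → SignType) (i : Fin d) :
    vec τ i = 0 ∨ vec τ i = 1 ∨ vec τ i = -1 := by
  unfold vec; generalize τ i = s; revert s; decide

theorem supNorm_vec_le {d : ℕ} (τ : Fin d → SignType) : supNorm (vec τ) ≤ 1 := by
  rw [supNorm_le_iff]
  intro i
  have := vec_cases τ i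
  omega

theorem vec_shellType {d : ℕ} (a : Fin d → ℤ) (i : Fin d) :
    (a i = supNorm a ∧ 0 < a i ∧ vec (shellType a) i = 1) ∨
    (a i = -supNorm a ∧ a i < 0 ∧ vec (shellType a) i = -1) ∨
    ((a i).natAbs < supNorm a ∧ vec (shellType a) i = 0) ∨
    (supNorm a = 0 ∧ a i = 0 ∧ vec (shellType a) i = 0) := by
  have h1 := @shellType_eq_one_iff d a i
  have h2 := @shellType_eq_neg_one_iff d a i
  rw [← vec_eq_one_iff] at h1
  rw [← vec_eq_neg_one_iff] at h2
  have h3 := vec_cases (shellType a) i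
  have h4 := natAbs_le_supNorm a i
  omega

theorem vec_apply_inj {d : ℕ} {σ τ : Fin d → SignType} {i : Fin d} :
    vec σ i = vec τ i ↔ σ i = τ i := by
  unfold vec; generalize σ i = s; generalize τ i = t; revert s t; decide

theorem vec_injective {d : ℕ} : Function.Injective (vec (d := d)) := fun _ _ h =>
  funext fun i => vec_apply_inj.1 (congrFun h i)

/-- Moving inwards along the shell type decreases the sup norm by one. -/
theorem supNorm_sub_vec_shellType {d : ℕ} {a : Fin d → ℤ} (ha : a ≠ 0) :
    supNorm (a - vec (shellType a)) + 1 = supNorm a := by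
  obtain ⟨i, hi⟩ := exists_natAbs_eq_supNorm ha
  have h0 : supNorm a ≠ 0 := fun h => ha (supNorm_eq_zero.1 h)
  have h1 : supNorm (a - vec (shellType a)) ≤ supNorm a - 1 := by
    rw [supNorm_le_iff]
    intro j
    have := vec_shellType a j
    simp only [Pi.sub_apply]
    omega
  have h2 := natAbs_le_supNorm (a - vec (shellType a)) i
  have h3 := vec_shellType a i
  simp only [Pi.sub_apply] at h2
  omega

/-- Moving inwards extends the shell type, until the centre is reached. -/
theorem shellType_sub_vec_shellType {d : ℕ} {a : Fin d → ℤ}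
    (h : shellType (a - vec (shellType a)) ≠ 0) {i : Fin d} (hi : shellType a i ≠ 0) :
    shellType (a - vec (shellType a)) i = shellType a i := by
  have ha : a ≠ 0 := by
    rintro rfl
    exact hi (congrFun (shellType_eq_zero.2 rfl) i)
  have hb : supNorm (a - vec (shellType a)) ≠ 0 := fun h0 =>
    h (shellType_eq_zero.2 (supNorm_eq_zero.1 h0))
  have h1 := supNorm_sub_vec_shellType ha
  have h2 := vec_shellType a i
  have h3 := vec_shellType (a - vec (shellType a)) i
  rw [Ne, ← vec_eq_zero_iff] at hi
  rw [← vec_apply_inj]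
  simp only [Pi.sub_apply] at h3
  omega

/-- The shell types around `a` in the outward directions are determined by that of `a`. -/
theorem shellType_add_vec {d : ℕ} {a : Fin d → ℤ} {τ : Fin d → SignType} (hτ : τ ≠ 0)
    (h : a = 0 ∨ ∀ i, τ i ≠ 0 → shellType a i = τ i) : shellType (a + vec τ) = τ := by
  obtain ⟨k, hk⟩ := Function.ne_iff.1 hτ
  -- Where `τ` is nonzero, `a` already attains its norm with a compatible sign. Adding `vec τ`
  -- therefore raises the norm by exactly one, and the coordinates left unchanged are no longer
  -- maximal.
  have key : ∀ i, τ i ≠ 0 → (a i).natAbs = supNorm a ∧ 0 ≤ a i * vec τ i := by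
    intro i hi
    rcases h with rfl | h
    · simp [supNorm_eq_zero.2]
    · have h1 := vec_shellType a i
      have h2 : vec (shellType a) i = vec τ i := by simp only [vec, h i hi]
      rw [h2] at h1
      rw [Ne, ← vec_eq_zero_iff] at hi
      rcases h1 with h1 | h1 | h1 | h1
      · rw [h1.2.2]; omega
      · rw [h1.2.2]; omega
      · omega
      · omega
  have hn : supNorm (a + vec τ) = supNorm a + 1 := by
    refine le_antisymm ((supNorm_add_le _ _).trans (by have := supNorm_vec_le τ; omega)) ?_
    have h1 := natAbs_le_supNorm (a + vec τ) k
    have h2 := key k hk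
    have h3 := vec_cases τ k
    rw [Pi.zero_apply, Ne, ← vec_eq_zero_iff] at hk
    simp only [Pi.add_apply] at h1
    rcases h3 with h3 | h3 | h3 <;> rw [h3] at h1 h2 <;> omega
  refine vec_injective (funext fun i => ?_)
  have h1 := vec_shellType (a + vec τ) i
  have h2 := natAbs_le_supNorm a i
  rw [hn, Pi.add_apply] at h1
  rcases eq_or_ne (τ i) 0 with hi | hi
  · rw [← vec_eq_zero_iff] at hi
    omega
  · have h3 := key i hi
    rw [Ne, ← vec_eq_zero_iff] at hi
    rcases vec_cases τ i with h4 | h4 | h4 <;> rw [h4] at h1 h3 ⊢ <;> omega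

/-! #### The automaton -/

/-- The Moore neighbourhood. -/
noncomputable def moore (d : ℕ) : Finset (Fin d → ℤ) := (finite_setOf_supNorm_le d 1).toFinset

theorem mem_moore {d : ℕ} {u : Fin d → ℤ} : u ∈ moore d ↔ supNorm u ≤ 1 := by simp [moore]

theorem single_mem_moore {d : ℕ} (i : Fin d) : Pi.single i 1 ∈ moore d := by
  rw [mem_moore, supNorm_le_iff]
  intro j
  rcases eq_or_ne j i with rfl | h
  · simp
  · simp [h]

/-- The local pattern `w` is that of the shell types around some `a`, where cells further outwards
than `a` may be fluid. -/
def IsStable {d : ℕ} (w : Config (State d) d) : Prop :=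
  ∃ a, ∀ u ∈ moore d, w u = .inl (shellType (a + u)) ∨
    (supNorm a < supNorm (a + u) ∧ ∃ b, w u = .inr b)

/-- The bit that reaches a fluid cell: that of the neighbour in direction `i` if it is fluid,
otherwise that of the neighbour in direction `j`. -/
def flow {d : ℕ} (i j : Fin d) (w : Config (State d) d) : State d :=
  match w (Pi.single i 1) with
  | .inr b => .inr b
  | .inl _ => match w (Pi.single j 1) with
    | .inr b => .inr b
    | .inl _ => .inr false

open Classical in
/-- Stable solid cells persist; all other cells are fluid from now on. -/
noncomputable def step {d : ℕ} (i j : Fin d) (w : Config (State d) d) : State d :=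
  if IsStable w then w 0 else flow i j w

open Classical in
/-- Solid cells persist where the pattern of shell types is intact in the inward directions and
contradicted nowhere; the fluid flows around them. -/
noncomputable def automaton {d : ℕ} (i j : Fin d) : CellularAutomaton (State d) d where
  nbhd := moore d
  rule w := step i j fun v => if h : v ∈ moore d then w ⟨v, h⟩ else .inr false

/-- The padding of the rule by fluid is harmless, since stability and flow read only Moore
neighbours. -/
theorem globalMap_automaton {d : ℕ} (i j : Fin d) (z : Config (State d) d) (m : Fin d → ℤ) :
    (automaton i j).globalMap z m = step i j fun u => z (m + u) := by
  have h0 : (0 : Fin d → ℤ) ∈ moore d := mem_moore.2 (by simp [supNorm_eq_zero.2])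
  have hs : IsStable (fun u => if u ∈ moore d then z (m + u) else .inr false) ↔
      IsStable fun u => z (m + u) := by
    unfold IsStable
    refine exists_congr fun a => forall₂_congr fun u hu => ?_
    simp only [if_pos hu]
  simp only [CellularAutomaton.globalMap, automaton, dite_eq_ite, step, flow,
    single_mem_moore, h0, if_true]
  classical exact if_congr hs rfl rfl

/-- The cell `m` of `z` is solid. -/
def IsSolid {d : ℕ} (z : Config (State d) d) (m : Fin d → ℤ) : Prop := ∃ τ, z m = .inl τ

theorem not_isSolid_iff {d : ℕ} {z : Config (State d) d} {m : Fin d → ℤ} :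
    ¬ IsSolid z m ↔ ∃ b, z m = .inr b := by
  unfold IsSolid
  rcases z m with τ | b <;> simp

variable {d : ℕ} {i j : Fin d} {z : Config (State d) d} {m : Fin d → ℤ}

theorem globalMap_of_isStable (h : IsStable fun u => z (m + u)) :
    (automaton i j).globalMap z m = z m := by
  rw [globalMap_automaton, step, if_pos h, add_zero]

theorem flow_eq_inr (w : Config (State d) d) : ∃ b, flow i j w = .inr b := by
  unfold flow
  split
  · exact ⟨_, rfl⟩
  · split <;> exact ⟨_, rfl⟩

/-- At `u = 0` the fluid alternative would need `supNorm a < supNorm a`. -/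
theorem IsStable.isSolid (h : IsStable fun u => z (m + u)) : IsSolid z m := by
  obtain ⟨a, ha⟩ := h
  rcases ha 0 (mem_moore.2 (by simp [supNorm_eq_zero.2])) with h | h
  · exact ⟨_, by simpa using h⟩
  · simp at h

theorem isSolid_globalMap_iff :
    IsSolid ((automaton i j).globalMap z) m ↔ IsStable fun u => z (m + u) := by
  refine ⟨fun h => by_contra fun hs => ?_, fun h => ?_⟩
  · obtain ⟨τ, hτ⟩ := h
    obtain ⟨b, hb⟩ := flow_eq_inr (i := i) (j := j) fun u => z (m + u)
    rw [globalMap_automaton, step, if_neg hs, hb] at hτ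
    cases hτ
  · rw [IsSolid, globalMap_of_isStable h]
    exact h.isSolid

theorem globalMap_of_not_isSolid (h : ¬ IsSolid z m) :
    (automaton i j).globalMap z m = flow i j fun u => z (m + u) := by
  rw [globalMap_automaton, step, if_neg fun hs => h hs.isSolid]

theorem globalMap_eq_inl {τ : Fin d → SignType}
    (h : (automaton i j).globalMap z m = .inl τ) : z m = .inl τ := by
  rwa [globalMap_of_isStable (isSolid_globalMap_iff.1 ⟨τ, h⟩)] at h

theorem iterate_eq_inl {n k : ℕ} (hnk : n ≤ k) {τ : Fin d → SignType}
    (h : (automaton i j).globalMap^[k] z m = .inl τ) :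
    (automaton i j).globalMap^[n] z m = .inl τ := by
  induction k, hnk using Nat.le_induction with
  | base => exact h
  | succ k _ ih =>
    rw [Function.iterate_succ_apply'] at h
    exact ih (globalMap_eq_inl h)

theorem isSolid_iterate_anti {n k : ℕ} (hnk : n ≤ k)
    (h : IsSolid ((automaton i j).globalMap^[k] z) m) :
    IsSolid ((automaton i j).globalMap^[n] z) m :=
  h.imp fun _ => iterate_eq_inl hnk

/-! #### Perfect configurations -/

/-- The configuration of shell types around `c`. -/
noncomputable def perfect {d : ℕ} (c : Fin d → ℤ) : Config (State d) d :=
  fun m => .inl (shellType (m - c))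

theorem perfect_injective : Function.Injective (perfect (d := d)) := by
  intro c c' h
  have h1 := Sum.inl.inj (congrFun h c)
  rw [sub_self, shellType_eq_zero.2 rfl, eq_comm, shellType_eq_zero] at h1
  exact sub_eq_zero.1 h1

/-- A perturbation of a perfect configuration outside a ball around the centre never enters
the ball. -/
theorem iterate_eq_perfect {c : Fin d → ℤ} {K : ℕ}
    (hz : ∀ m, supNorm (m - c) ≤ K + 1 → z m = perfect c m) (n : ℕ) :
    ∀ m, supNorm (m - c) ≤ K → (automaton i j).globalMap^[n] z m = perfect c m := by
  induction n with
  | zero => exact fun m hm => hz m (by omega)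
  | succ n ih =>
    intro m hm
    rw [Function.iterate_succ_apply', globalMap_of_isStable, ih m hm]
    refine ⟨m - c, fun u hu => ?_⟩
    rw [mem_moore] at hu
    beta_reduce
    have h1 : m + u - c = m - c + u := by abel
    have h2 := supNorm_add_le (m - c) u
    -- Neighbours not further out are perfect by induction. Those further out either have always
    -- been solid, hence keep their initial perfect state, or are fluid, which stability allows.
    rcases le_or_gt (supNorm (m - c + u)) (supNorm (m - c)) with h | h
    · left
      rw [ih _ (by rw [h1]; omega), perfect, h1]
    · by_cases hs : IsSolid ((automaton i j).globalMap^[n] z) (m + u)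
      · left
        obtain ⟨τ, hτ⟩ := hs
        rw [hτ, ← iterate_eq_inl (Nat.zero_le n) hτ, Function.iterate_zero, id,
          hz _ (by rw [h1]; omega), perfect, h1]
      · exact Or.inr ⟨h, not_isSolid_iff.1 hs⟩

theorem isEquicontinuousPoint_perfect (i j : Fin d) (c : Fin d → ℤ) :
    (automaton i j).IsEquicontinuousPoint (perfect c) := by
  rw [CellularAutomaton.isEquicontinuousPoint_iff]
  -- Each `supNorm c` pays for a change between balls around the origin and around `c`; the `1` is
  -- the protective layer of `iterate_eq_perfect`.
  refine fun k => ⟨k + supNorm c + 1 + supNorm c, fun y hy n m hm => ?_⟩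
  have hm' : supNorm (m - c) ≤ k + supNorm c := by
    have := supNorm_add_le m (-c)
    rw [supNorm_neg, ← sub_eq_add_neg] at this
    omega
  rw [iterate_eq_perfect (fun _ _ => rfl) n m hm', iterate_eq_perfect (fun l hl => ?_) n m hm']
  refine (hy l ?_).symm
  have := supNorm_add_le (l - c) c
  rw [sub_add_cancel] at this
  omega

/-- A configuration with a centre in which all local patterns are intact is perfect. -/
theorem eq_perfect {c : Fin d → ℤ} (hc : z c = .inl 0)
    (h : ∀ m, ∃ a, ∀ u ∈ moore d, z (m + u) = .inl (shellType (a + u))) : z = perfect c := by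
  have key : ∀ k : ℕ, ∀ w : Fin d → ℤ, supNorm w = k → z (c + w) = .inl (shellType w) := by
    intro k
    induction k with
    | zero =>
      intro w hw
      rw [supNorm_eq_zero] at hw
      rw [hw, add_zero, hc, shellType_eq_zero.2 rfl]
    | succ k ih =>
      intro w hw
      have hw0 : w ≠ 0 := fun h0 => by rw [supNorm_eq_zero.2 h0] at hw; omega
      have ih' := ih (w - vec (shellType w)) (by have := supNorm_sub_vec_shellType hw0; omega)
      -- The position `a` need not be `w - vec (shellType w)`, but the two have the same shell type,
      -- and that determines the state one step outwards.
      obtain ⟨a, ha⟩ := h (c + (w - vec (shellType w)))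
      have h0 := ha 0 (mem_moore.2 (by simp [supNorm_eq_zero.2]))
      have h1 := ha _ (mem_moore.2 (supNorm_vec_le (shellType w)))
      rw [add_zero, add_zero, ih'] at h0
      have h2 := Sum.inl.inj h0
      rw [show c + (w - vec (shellType w)) + vec (shellType w) = c + w by abel] at h1
      rw [h1, shellType_add_vec (mt shellType_eq_zero.1 hw0)]
      rcases eq_or_ne (shellType (w - vec (shellType w))) 0 with h3 | h3
      · exact Or.inl (shellType_eq_zero.1 (h2.symm.trans h3))
      · exact Or.inr fun l hl => by rw [← h2, shellType_sub_vec_shellType h3 hl]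
  funext m
  simpa [perfect] using key _ (m - c) rfl

/-! #### Finitely many solid cells -/

/-- If all solid cells are stable and finite in number, one of them is a centre. -/
theorem exists_centre (hfin : {m | IsSolid z m}.Finite) (hne : {m | IsSolid z m}.Nonempty)
    (hst : ∀ m, IsSolid z m → IsStable fun u => z (m + u)) : ∃ c, z c = .inl 0 := by
  by_contra! hno
  obtain ⟨p, σ, hp⟩ := hne
  have hσ : σ ≠ 0 := by rintro rfl; exact hno p hp
  obtain ⟨k, hk⟩ := Function.ne_iff.1 hσ
  -- Take a cell of the cluster furthest inwards in coordinate `k`. Its inward neighbour is solid by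
  -- stability and, not being a centre, keeps the sign `σ k`, yet lies one step further inwards.
  obtain ⟨m, ⟨τ, hm, hτ⟩, hmin⟩ := Set.exists_min_image
    {m | ∃ τ, z m = .inl τ ∧ τ k = σ k} (fun m => m k * vec σ k)
    (hfin.subset fun m ⟨τ, hm, _⟩ => ⟨τ, hm⟩) ⟨p, σ, hp, rfl⟩
  obtain ⟨a, ha⟩ := hst m ⟨τ, hm⟩
  beta_reduce at ha
  have h0 := ha 0 (mem_moore.2 (by simp [supNorm_eq_zero.2]))
  simp only [add_zero, hm, Sum.inl.injEq, lt_irrefl, false_and, or_false] at h0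
  have ha0 : a ≠ 0 := by
    rintro rfl
    exact hk (by rw [← hτ, h0, shellType_eq_zero.2 rfl])
  have hlt := supNorm_sub_vec_shellType ha0
  have h1 := ha (-vec τ) (mem_moore.2 (by rw [supNorm_neg]; exact supNorm_vec_le τ))
  rw [h0, ← sub_eq_add_neg, ← sub_eq_add_neg] at h1
  rcases h1 with h1 | h1
  · have h2 : shellType (a - vec (shellType a)) ≠ 0 := fun h => hno _ (by rw [h1, h])
    have h3 : shellType (a - vec (shellType a)) k = σ k := by
      rw [shellType_sub_vec_shellType h2 (by rw [← h0, hτ]; exact hk), ← h0, hτ]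
    have h4 := hmin _ ⟨_, h1, h3⟩
    have h5 : vec (shellType a) k = vec σ k := by rw [vec_apply_inj, ← h0, hτ]
    rw [Pi.zero_apply, Ne, ← vec_eq_zero_iff] at hk
    simp only [Pi.sub_apply, h5] at h4
    rcases vec_cases σ k with h6 | h6 | h6 <;> rw [h6] at h4 <;> omega
  · omega

/-- Stable solid clusters have no concave corner that blocks both flow directions. -/
theorem not_isSolid_or (hij : i ≠ j) (hst : ∀ m, IsSolid z m → IsStable fun u => z (m + u))
    (hm : ¬ IsSolid z m) :
    ¬ IsSolid z (m + Pi.single i 1) ∨ ¬ IsSolid z (m + Pi.single j 1) := by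
  by_contra! h
  -- The fluid cell `m` lies strictly further out than the solid cell `m + Pi.single k 1`, so that
  -- cell lies on the negative `k`-face.
  have out : ∀ k : Fin d, ∀ a : Fin d → ℤ, (∀ u ∈ moore d,
      z (m + Pi.single k 1 + u) = .inl (shellType (a + u)) ∨ (supNorm a < supNorm (a + u) ∧
      ∃ b, z (m + Pi.single k 1 + u) = .inr b)) → a k = -supNorm a := by
    intro k a ha
    have h1 := ha (-Pi.single k 1) (mem_moore.2 (by
      rw [supNorm_neg, ← mem_moore]; exact single_mem_moore k))
    rw [add_neg_cancel_right] at h1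
    rcases h1 with h1 | ⟨h1, -⟩
    · exact absurd ⟨_, h1⟩ hm
    · by_contra hk
      refine absurd h1 (not_lt.2 (supNorm_le_iff.2 fun l => ?_))
      have hl := natAbs_le_supNorm a l
      rcases eq_or_ne l k with rfl | hlk
      · simp only [Pi.add_apply, Pi.neg_apply, Pi.single_eq_same]; omega
      · simpa [hlk] using hl
  obtain ⟨a, ha⟩ := hst _ h.1
  obtain ⟨b, hb⟩ := hst _ h.2
  beta_reduce at ha hb
  have hai := out i a ha
  have hbj := out j b hb
  have hji : (Pi.single j 1 - Pi.single i 1 : Fin d → ℤ) ∈ moore d := by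
    rw [mem_moore, supNorm_le_iff]
    intro l
    rcases eq_or_ne l i with rfl | hl
    · simp [hij]
    · rcases eq_or_ne l j with rfl | hl'
      · simp [hl]
      · simp [hl, hl']
  have h1 := ha _ hji
  have h2 := hb 0 (mem_moore.2 (by simp [supNorm_eq_zero.2]))
  simp only [add_zero, lt_irrefl, false_and, or_false] at h2
  rw [show m + Pi.single i 1 + (Pi.single j 1 - Pi.single i 1) = m + Pi.single j 1 by abel,
    h2] at h1
  simp only [Sum.inl.injEq, reduceCtorEq, exists_false, and_false, or_false] at h1
  -- The cell `m + Pi.single j 1` has the shell types of both `e` and `b`. That of `e` is `-1` at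
  -- `i` and not `-1` at `j`. Since `b j = -supNorm b`, the latter forces `b = 0`, against the
  -- former.
  set e : Fin d → ℤ := a + (Pi.single j 1 - Pi.single i 1) with he
  have hei : e i = a i - 1 := by simp [he, hij, sub_eq_add_neg]
  have hej : e j = a j + 1 := by simp [he, hij.symm]
  have hn : supNorm e ≤ supNorm a + 1 :=
    (supNorm_add_le _ _).trans (Nat.add_le_add_left (mem_moore.1 hji) _)
  have h3 := vec_shellType b j
  rw [h1] at h3
  have h4 := vec_shellType e j
  have h5 := natAbs_le_supNorm e i
  have h6 := natAbs_le_supNorm a j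
  have h7 := vec_shellType e i
  have h8 := vec_shellType b i
  rw [h1] at h8
  omega

/-- The solid sets are finite and decreasing, so they are constant from a time of least cardinality
on. -/
theorem exists_forall_isStable {R : ℕ} (hz : ∀ m, R < supNorm m → ¬ IsSolid z m) :
    ∃ T, ∀ n, T ≤ n → ∀ m, IsSolid ((automaton i j).globalMap^[n] z) m ↔
      IsSolid ((automaton i j).globalMap^[T] z) m := by
  have hfin : ∀ n, {m | IsSolid ((automaton i j).globalMap^[n] z) m}.Finite := fun n =>
    (finite_setOf_supNorm_le d R).subset fun m hm => by
      by_contra h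
      exact hz m (not_le.1 h) (isSolid_iterate_anti (Nat.zero_le n) hm)
  let f := fun n => {m | IsSolid ((automaton i j).globalMap^[n] z) m}.ncard
  refine ⟨Function.argmin f, fun n hn m => ⟨isSolid_iterate_anti hn, fun hm => ?_⟩⟩
  have h := Set.eq_of_subset_of_ncard_le (fun m hm => isSolid_iterate_anti hn hm)
    (Function.argmin_le f n) (hfin _)
  exact h.symm.subset hm

theorem isSolid_iterate_isStable {T : ℕ}
    (hT : ∀ n, T ≤ n → ∀ m, IsSolid ((automaton i j).globalMap^[n] z) m ↔
      IsSolid ((automaton i j).globalMap^[T] z) m) :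
    ∀ m, IsSolid ((automaton i j).globalMap^[T] z) m →
      IsStable fun u => (automaton i j).globalMap^[T] z (m + u) := by
  intro m hm
  rwa [← isSolid_globalMap_iff (i := i) (j := j), ← Function.iterate_succ_apply' (automaton i j).globalMap,
    hT _ (Nat.le_succ T)]

/-- In a fluid that has the bit `b` outside a ball, every cell that is fluid at some time
eventually has the bit `b`. -/
theorem eventually_eq_inr (hij : i ≠ j) {R : ℕ} {b : Bool}
    (hz : ∀ m, R < supNorm m → z m = .inr b) {n₀ : ℕ}
    (hm : ¬ IsSolid ((automaton i j).globalMap^[n₀] z) m) :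
    ∃ N, ∀ n, N ≤ n → (automaton i j).globalMap^[n] z m = .inr b := by
  obtain ⟨T, hT⟩ := exists_forall_isStable (i := i) (j := j) (z := z) (R := R) fun m hm =>
    not_isSolid_iff.2 ⟨b, hz m hm⟩
  -- This half-space misses the ball and is closed under the step in direction `i`, so it always
  -- reads its own bit.
  have hfar : ∀ n, ∀ m : Fin d → ℤ, 2 * (R : ℤ) < m i + m j →
      (automaton i j).globalMap^[n] z m = .inr b := by
    intro n
    have hR : ∀ m : Fin d → ℤ, 2 * (R : ℤ) < m i + m j → z m = .inr b := fun m hm => by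
      refine hz m (by_contra fun h => ?_)
      have h1 := natAbs_le_supNorm m i
      have h2 := natAbs_le_supNorm m j
      omega
    induction n with
    | zero => exact hR
    | succ n ih =>
      intro m hm
      rw [Function.iterate_succ_apply',
        globalMap_of_not_isSolid (not_isSolid_iff.2 ⟨b, ih m hm⟩), flow,
        ih (m + Pi.single i 1) (by simp [hij.symm]; omega)]
  -- Following the flow upstream raises `m i + m j` by one per step, so the half-space is reached
  -- after finitely many fluid cells.
  have key : ∀ k : ℕ, ∀ m : Fin d → ℤ, 2 * (R : ℤ) < m i + m j + k →
      ¬ IsSolid ((automaton i j).globalMap^[T] z) m →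
      ∃ N, ∀ n, N ≤ n → (automaton i j).globalMap^[n] z m = .inr b := by
    intro k
    induction k with
    | zero => exact fun m hm _ => ⟨0, fun n _ => hfar n m (by simpa using hm)⟩
    | succ k ih =>
      intro m hm hs
      have hfl : ∀ n, T ≤ n → (automaton i j).globalMap^[n + 1] z m =
          flow i j fun u => (automaton i j).globalMap^[n] z (m + u) := fun n hn => by
        rw [Function.iterate_succ_apply', globalMap_of_not_isSolid (by rwa [hT n hn])]
      by_cases hi : IsSolid ((automaton i j).globalMap^[T] z) (m + Pi.single i 1)
      · have hj := (not_isSolid_or hij (isSolid_iterate_isStable hT) hs).resolve_left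
          (not_not.2 hi)
        obtain ⟨N, hN⟩ := ih (m + Pi.single j 1) (by simp [hij]; omega) hj
        refine ⟨max N T + 1, fun n hn => ?_⟩
        obtain ⟨n, rfl⟩ : ∃ n', n = n' + 1 := ⟨n - 1, by omega⟩
        obtain ⟨τ, hτ⟩ := (hT n (by omega) _).2 hi
        rw [hfl n (by omega), flow, hτ]
        simp only [hN n (by omega)]
      · obtain ⟨N, hN⟩ := ih (m + Pi.single i 1) (by simp [hij.symm]; omega) hi
        refine ⟨max N T + 1, fun n hn => ?_⟩
        obtain ⟨n, rfl⟩ : ∃ n', n = n' + 1 := ⟨n - 1, by omega⟩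
        rw [hfl n (by omega), flow, hN n (by omega)]
  refine key (2 * (R : ℤ) - (m i + m j) + 1).toNat m (by omega) fun h => hm ?_
  rcases le_total n₀ T with h' | h'
  · exact isSolid_iterate_anti h' h
  · exact (hT n₀ h' m).2 h

/-! #### The equicontinuous points -/

open Classical in
/-- The configuration `x` inside the ball of radius `R`, and fluid with the bit `b` outside. -/
noncomputable def immerse {d : ℕ} (x : Config (State d) d) (R : ℕ) (b : Bool) :
    Config (State d) d :=
  fun m => if supNorm m ≤ R then x m else .inr b

theorem agreeOn_immerse {x : Config (State d) d} {R : ℕ} {b : Bool} :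
    AgreeOn R x (immerse x R b) := fun m hm => by rw [immerse, if_pos hm]

theorem immerse_of_lt {x : Config (State d) d} {R : ℕ} {b : Bool} (hm : R < supNorm m) :
    immerse x R b m = .inr b := by rw [immerse, if_neg (not_le.2 hm)]

/-- Around an equicontinuous point, no cell is ever fluid. -/
theorem isSolid_iterate_immerse (hij : i ≠ j) {x : Config (State d) d} {k R : ℕ}
    (h : ∀ y, AgreeOn R x y → ∀ n,
      AgreeOn k ((automaton i j).globalMap^[n] x) ((automaton i j).globalMap^[n] y))
    (hm : supNorm m ≤ k) (n : ℕ) :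
    IsSolid ((automaton i j).globalMap^[n] (immerse x R false)) m := by
  by_contra hs
  -- Both immersions follow the orbit of `x` at `m`, whereas a melted cell would eventually show
  -- different bits in the two.
  have heq : ∀ n, (automaton i j).globalMap^[n] (immerse x R false) m =
      (automaton i j).globalMap^[n] (immerse x R true) m := fun n =>
    (h _ agreeOn_immerse n m hm).symm.trans (h _ agreeOn_immerse n m hm)
  have hs' : ¬ IsSolid ((automaton i j).globalMap^[n] (immerse x R true)) m := by
    rwa [IsSolid, ← heq]
  obtain ⟨N, hN⟩ := eventually_eq_inr hij (fun _ => immerse_of_lt) hs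
  obtain ⟨N', hN'⟩ := eventually_eq_inr hij (fun _ => immerse_of_lt) hs'
  have h1 := heq (max N N')
  rw [hN _ (le_max_left _ _), hN' _ (le_max_right _ _)] at h1
  simp at h1

theorem exists_eq_perfect (hij : i ≠ j) {x : Config (State d) d}
    (hx : (automaton i j).IsEquicontinuousPoint x) : ∃ c, x = perfect c := by
  rw [CellularAutomaton.isEquicontinuousPoint_iff] at hx
  have hloc : ∀ m, ∃ a, ∀ u ∈ moore d, x (m + u) = .inl (shellType (a + u)) := by
    intro m
    -- This ball contains the Moore neighbourhood of `m`. Solidity at time 1 gives stability at time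
    -- 0, and solidity of the neighbours excludes the fluid alternative.
    obtain ⟨R, hR⟩ := hx (supNorm m + 1)
    have h1 := isSolid_iterate_immerse hij hR (m := m) (by omega) 1
    rw [Function.iterate_one, isSolid_globalMap_iff] at h1
    obtain ⟨a, ha⟩ := h1
    beta_reduce at ha
    refine ⟨a, fun u hu => ?_⟩
    have hmu : supNorm (m + u) ≤ supNorm m + 1 :=
      (supNorm_add_le m u).trans (by rw [mem_moore] at hu; omega)
    have h2 : x (m + u) = immerse x R false (m + u) := hR _ agreeOn_immerse 0 _ hmu
    obtain ⟨τ, hτ⟩ := isSolid_iterate_immerse hij hR hmu 0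
    rw [h2]
    refine (ha u hu).resolve_right fun h3 => ?_
    obtain ⟨b, hb⟩ := h3.2
    rw [Function.iterate_zero, id, hb] at hτ
    cases hτ
  -- The origin alone never melting makes the final cluster nonempty. A centre is needed because
  -- intact local patterns also occur without one, as in a constant nonzero shell type.
  obtain ⟨R, hR⟩ := hx 0
  have hfl : ∀ m, R < supNorm m → ¬ IsSolid (immerse x R false) m := fun m hm =>
    not_isSolid_iff.2 ⟨false, immerse_of_lt hm⟩
  obtain ⟨T, hT⟩ := exists_forall_isStable (i := i) (j := j) hfl
  obtain ⟨c, hc⟩ := exists_centre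
    ((finite_setOf_supNorm_le d R).subset fun m hm => not_lt.1 fun h =>
      hfl m h (isSolid_iterate_anti (Nat.zero_le T) hm))
    ⟨0, isSolid_iterate_immerse hij hR (by rw [supNorm_eq_zero.2 rfl]) T⟩
    (isSolid_iterate_isStable hT)
  have hc' := iterate_eq_inl (Nat.zero_le T) hc
  have hcR : supNorm c ≤ R := not_lt.1 fun h => hfl c h ⟨_, hc'⟩
  exact ⟨c, eq_perfect ((agreeOn_immerse c hcR).trans hc') hloc⟩

theorem equicontinuousPoints_automaton (hij : i ≠ j) :
    (automaton i j).equicontinuousPoints = Set.range perfect :=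
  Set.Subset.antisymm (fun _ hx => (exists_eq_perfect hij hx).imp fun _ h => h.symm)
    (Set.range_subset_iff.2 (isEquicontinuousPoint_perfect i j))

end SolidFluid

theorem mainTheorem5 :
    (∀ d : ℕ, 2 ≤ d → ∃ (A : Type) (_ : Finite A) (F : CellularAutomaton A d),
      F.equicontinuousPoints.Countable ∧ F.equicontinuousPoints.Infinite) ∧
    (∀ (A : Type*) [Finite A] [Nontrivial A] (F : CellularAutomaton A 1),
      F.equicontinuousPoints.Nonempty → ¬ F.equicontinuousPoints.Countable) := by
  refine ⟨fun d hd => ?_, fun A _ _ F h => F.not_countable_equicontinuousPoints h⟩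
  let i : Fin d := ⟨0, by omega⟩
  let j : Fin d := ⟨1, by omega⟩
  have hij : i ≠ j := by simp [i, j]
  have : Nonempty (Fin d) := ⟨i⟩
  refine ⟨SolidFluid.State d, inferInstance, SolidFluid.automaton i j, ?_⟩
  rw [SolidFluid.equicontinuousPoints_automaton hij]
  exact ⟨Set.countable_range _, Set.infinite_range_of_injective SolidFluid.perfect_injective⟩
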